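/- Let $\mathsf Q$ be a probability measure and $\mathcal P$ a set of probability measures on a measurable space $(\Omega,\mathcal F)$. An e-variable is a measurable $X:\Omega\to[0,\infty]$ with $\mathbb E_{\mathsf P}[X]\le 1$ for all $\mathsf P\in\mathcal P$. A numeraire is a $\mathsf Q$-a.s. strictly positive e-variable $X^*$ such that $\mathbb E_{\mathsf Q}[X/X^*]\le 1$ for every e-variable $X$ (with $x/\infty=0$ and $\infty/x=\infty$ for $x<\infty$, and $\infty/\infty=1$). The reverse information projection (RIPr) is the measure $\mathsf P^*$ with $d\mathsf P^*/d\mathsf Q=1/X^*$, where $1/\infty=0$. For a finite measure $\mathsf P$ let $H(\mathsf Q\mid \mathsf P)=\mathbb E_{\mathsf Q}[\log (d\mathsf Q/d\mathsf P)]$ if $\mathsf Q\ll \mathsf P$, and $H(\mathsf Q\mid \mathsf P)=+\infty$ otherwise. Assume that $\mathsf Q\ll\mathcal P$, that is, $\mathsf Q(A)=0$ for every event $A$ with $\mathsf P(A)=0$ for all $\mathsf P\in\mathcal P$; that all elements of $\mathcal P$ are absolutely continuous with respect to a probability measure $\mu$; that $\mathcal P$ is convex; and that $H(\mathsf Q\mid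 \mathsf P)<\infty$ for some $\mathsf P\in\mathcal P$. Then the RIPr $\mathsf P^*$ exists and is unique. Write $p=d\mathsf P/d\mu$ for $\mathsf P\in\mathcal P$, and $p^*=d\mathsf P^*/d\mu$. 1. If $(\mathsf P_n)$ is an entropy minimizing sequence in $\mathcal P$, i.e. $\mathsf P_n \in \mathcal P$ and $H(\mathsf Q\mid \mathsf P_n)\to\inf_{\mathsf P\in\mathcal P}H(\mathsf Q\mid \mathsf P)$, then $\log p_n\to\log p^*$ in $L^1(\mathsf Q)$, i.e. $\mathbb E_{\mathsf Q}[|\log p_n-\log p^*|]\to 0$. 2. If $\mathsf P'\in\mathcal P$ achieves $\inf_{\mathsf P\in\mathcal P}H(\mathsf Q\mid \mathsf P)$, then $\mathsf P'$ is the RIPr up to $\mathsf Q$-nullsets: its density satisfies $p'=p^*$ $\mathsf Q$-a.s., and the absolutely continuous part of $\mathsf P'$ with respect to $\mathsf Q$ is $\mathsf P^*$. 3. $H(\mathsf Q\mid \mathsf P^*)=\inf_{\mathsf P\in\mathcal P}H(\mathsf Q\mid \mathsf P)$. 4. $p^*$ is, up to $\mathsf Q$-nullsets, the only measurable $g:\Omega\to[0,\infty]$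 such that $\log p_n\to\log g$ in $L^1(\mathsf Q)$ for every entropy minimizing sequence $(\mathsf P_n)$ in $\mathcal P$; thus the RIPr agrees with Li's definition. -/

import Mathlib

open MeasureTheory Filter Topology
open scoped ENNReal NNReal

noncomputable section

namespace RIPr

variable {Ω : Type*} [MeasurableSpace Ω]

/-- `Q` is absolutely continuous with respect to the family `H₀`: every event that is null under
all elements of `H₀` is null under `Q`. -/
def AbsContFamily (Q : Measure Ω) (H₀ : Set (Measure Ω)) : Prop :=
  ∀ A : Set Ω, MeasurableSet A → (∀ P ∈ H₀, P A = 0) → Q A = 0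

/-- E-variables for `H₀`: measurable `[0,∞]`-valued functions with expectation at most one under
every element of `H₀`. -/
def IsEVariable (H₀ : Set (Measure Ω)) (X : Ω → ℝ≥0∞) : Prop :=
  Measurable X ∧ ∀ P ∈ H₀, ∫⁻ ω, X ω ∂P ≤ 1

open Classical in
/-- The ratio `x / y` in `[0,∞]`, with `x / ∞ = 0` and `∞ / x = ∞` for finite `x`, and with
`∞ / ∞ = 1` (Mathlib's division has `∞ / ∞ = 0`). -/
def ratio (x y : ℝ≥0∞) : ℝ≥0∞ :=
  if x = ∞ ∧ y = ∞ then 1 else x / y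

/-- A numeraire for `H₀` and `Q`: a `Q`-almost surely strictly positive e-variable `Xstar` with
`E_Q[X / Xstar] ≤ 1` for every e-variable `X`. -/
def IsNumeraire (H₀ : Set (Measure Ω)) (Q : Measure Ω) (Xstar : Ω → ℝ≥0∞) : Prop :=
  IsEVariable H₀ Xstar ∧ (∀ᵐ ω ∂Q, 0 < Xstar ω) ∧
    ∀ X : Ω → ℝ≥0∞, IsEVariable H₀ X → ∫⁻ ω, ratio (X ω) (Xstar ω) ∂Q ≤ 1

/-- `Pstar` is the reverse information projection: the measure with density `1 / Xstar` with
respect to `Q`, where `Xstar` is a numeraire (the density is `0` where `Xstar = ∞`). -/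
def IsReverseInfoProj (H₀ : Set (Measure Ω)) (Q Pstar : Measure Ω) : Prop :=
  ∃ Xstar : Ω → ℝ≥0∞, IsNumeraire H₀ Q Xstar ∧ Pstar = Q.withDensity (fun ω => (Xstar ω)⁻¹)

/-- The expectation `E[f⁺] - E[f⁻]` of an extended real valued function. It is only used where
`E[f⁻]` is finite. -/
def eexpect (Q : Measure Ω) (f : Ω → EReal) : EReal :=
  ((∫⁻ ω, (f ω).toENNReal ∂Q : ℝ≥0∞) : EReal) - ((∫⁻ ω, (-(f ω)).toENNReal ∂Q : ℝ≥0∞) : EReal)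

open Classical in
/-- The entropy of `Q` relative to `P`: `E_Q[log (dQ/dP)]` if `Q ≪ P`, and `+∞` otherwise.
There is no adjustment when the total mass of `P` differs from one. -/
def relEntropy (Q P : Measure Ω) : EReal :=
  if Q ≪ P then eexpect Q (fun ω => ENNReal.log (Q.rnDeriv P ω)) else ⊤

/-- The distance `E_Q |log f - log g|` of `log f` and `log g` in `L¹(Q)`, in `[0,∞]`. Here
`log 0 = -∞` and `log ∞ = ∞`, and the integrand is `∞` wherever one of the logarithms is
infinite (`EReal.abs` sends both infinite values to `∞`). -/
def logL1Dist (Q : Measure Ω) (f g : Ω → ℝ≥0∞) : ℝ≥0∞ :=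
  ∫⁻ ω, (ENNReal.log (f ω) - ENNReal.log (g ω)).abs ∂Q

/-- The absolutely continuous part of `P` with respect to `Q`. -/
def acPart (P Q : Measure Ω) : Measure Ω :=
  Q.withDensity (P.rnDeriv Q)

/-- An entropy minimizing sequence in `H₀`. -/
def IsEntropyMinimizing (H₀ : Set (Measure Ω)) (Q : Measure Ω) (P : ℕ → Measure Ω) : Prop :=
  (∀ n, P n ∈ H₀) ∧
    Tendsto (fun n => relEntropy Q (P n)) atTop (𝓝 (⨅ P' ∈ H₀, relEntropy Q P'))

end RIPr

end

namespace RIPr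

variable {Ω : Type*} [MeasurableSpace Ω]

/-! ### Elementary inequalities -/

/-! Let `c` be the infimal entropy. If two elements of `H₀` both have entropy at most `c + δ`, their
midpoint lies in `H₀` and still has entropy at least `c`. So the Jensen gap of the logarithm, `log
cosh (d / 2)` with `d` the difference of the two log likelihood ratios, has `Q`-mean at most `δ`.
This gap controls `|d|` (`abs_le_of_log_mix`), so `llr Q P` is Cauchy in `L¹(Q)` along minimizing
sequences, with one common limit `f` (`exists_isEntropyLimit`,
`IsEntropyLimit.integral_abs_sub_le`).

The numeraire is `exp f`. Moving from a near-minimizer a little towards any `P ∈ H₀` hardly lowers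
the entropy; to first order this says `E_Q[dP/dQ · exp f] ≤ 1`, so `exp f`, set to zero off the
support of `Q`, is an e-variable. Conversely `E_Q[X · dPₙ/dQ] ≤ 1` for every e-variable `X`, and
Fatou gives `E_Q[X · exp (-f)] ≤ 1`. Two numeraires `X`, `Y` agree because `X/Y` and `Y/X` both have
mean at most one while `u + 1/u ≥ 2`.

Hence the projection is `exp (-f) · Q`, with entropy `E_Q[f] = c`. Since `log dP/dμ = log dQ/dμ -
llr Q P`, convergence of log densities is convergence of log likelihood ratios. -/

lemma abs_le_log_cosh (x : ℝ) :
    |x| ≤ Real.log (Real.cosh x) + √(2 * Real.log (Real.cosh x)) := by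
  have hcosh : Real.cosh x = Real.cosh |x| := (Real.cosh_abs x).symm
  rw [hcosh]
  have hc1 : 1 ≤ Real.cosh |x| := Real.one_le_cosh _
  have hc : 0 < Real.cosh |x| := by linarith
  set g := Real.log (Real.cosh |x|) with hg
  have hg0 : 0 ≤ g := Real.log_nonneg hc1
  have hexp : Real.exp g = Real.cosh |x| := Real.exp_log hc
  -- Here `sinh² = cosh² - 1 = e^{2g} - 1 ≤ 2g e^{2g}`. The claim then follows from `e^{|x|} = cosh
  -- + sinh ≤ e^g (1 + √(2g))`.
  have hsinh : Real.sinh |x| ≤ Real.exp g * √(2 * g) := by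
    apply le_of_sq_le_sq _ (by positivity)
    rw [mul_pow, Real.sq_sqrt (by linarith), Real.sinh_sq, ← hexp]
    have h1 := Real.add_one_le_exp (-(2 * g))
    have h2 : Real.exp g ^ 2 * Real.exp (-(2 * g)) = 1 := by
      rw [← Real.exp_nat_mul, ← Real.exp_add]
      norm_num
    nlinarith [sq_nonneg (Real.exp g)]
  have : Real.exp |x| ≤ Real.exp (g + √(2 * g)) := by
    rw [← Real.cosh_add_sinh, ← hexp, Real.exp_add]
    have := Real.add_one_le_exp (√(2 * g))
    nlinarith [Real.exp_pos g]
  exact Real.exp_le_exp.1 this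

/-- The bracket is `log cosh (d / 2)`. The free parameter `s` linearises the square root in
`abs_le_log_cosh` by AM-GM, so that the bound can be integrated; `s = √δ` is used later. -/
lemma abs_le_of_log_mix (d s : ℝ) (hs : 0 < s) :
    |d| ≤ (2 + 2 / s) * (Real.log (1 / 2 + 1 / 2 * Real.exp d) - d / 2) + s := by
  have hc : 0 < Real.cosh (d / 2) := Real.cosh_pos _
  have h1 : 1 / 2 + 1 / 2 * Real.exp d = Real.exp (d / 2) * Real.cosh (d / 2) := by
    rw [Real.cosh_eq]
    have h2 : Real.exp d = Real.exp (d / 2) * Real.exp (d / 2) := by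
      rw [← Real.exp_add]; ring_nf
    have h3 : Real.exp (d / 2) * Real.exp (-(d / 2)) = 1 := by
      rw [← Real.exp_add]; simp
    linarith
  rw [h1, Real.log_mul (Real.exp_pos _).ne' hc.ne', Real.log_exp]
  have h2 := abs_le_log_cosh (d / 2)
  set g := Real.log (Real.cosh (d / 2))
  have hg0 : 0 ≤ g := Real.log_nonneg (Real.one_le_cosh _)
  rw [abs_div, abs_two] at h2
  have h3 : √(2 * g) ≤ g / s + s / 2 := by
    apply Real.sqrt_le_iff.2 ⟨by positivity, ?_⟩
    have : (g / s + s / 2) ^ 2 = 2 * g + (g / s - s / 2) ^ 2 := by field_simp; ring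
    rw [this]
    nlinarith [sq_nonneg (g / s - s / 2)]
  have h4 : (2 + 2 / s) * (d / 2 + g - d / 2) + s = 2 * (g + (g / s + s / 2)) := by
    field_simp; ring
  rw [h4]
  linarith

/-! ### Relative entropy as an integral -/

lemma eexpect_eq_integral {Q : Measure Ω} {f : Ω → EReal} {g : Ω → ℝ} (hg : Integrable g Q)
    (h : f =ᵐ[Q] fun ω => (g ω : EReal)) : eexpect Q f = ((∫ ω, g ω ∂Q : ℝ) : EReal) := by
  have h1 : ∫⁻ ω, (f ω).toENNReal ∂Q = ∫⁻ ω, ENNReal.ofReal (g ω) ∂Q :=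
    lintegral_congr_ae (h.mono fun ω hω => by simp [hω])
  have h2 : ∫⁻ ω, (-(f ω)).toENNReal ∂Q = ∫⁻ ω, ENNReal.ofReal (-g ω) ∂Q :=
    lintegral_congr_ae (h.mono fun ω hω => by
      simp only [hω, ← EReal.coe_neg, EReal.toENNReal_of_ne_top (EReal.coe_ne_top _),
        EReal.toReal_coe])
  have hneg : ∫⁻ ω, ENNReal.ofReal (-g ω) ∂Q ≠ ⊤ := hg.neg.lintegral_lt_top.ne
  rw [eexpect, h1, h2, integral_eq_lintegral_pos_part_sub_lintegral_neg_part hg, EReal.coe_sub,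
    EReal.coe_ennreal_toReal hg.lintegral_lt_top.ne,
    EReal.coe_ennreal_toReal hneg]

lemma log_rnDeriv_ae {Q P : Measure Ω} [SigmaFinite Q] [SigmaFinite P] (h : Q ≪ P) :
    (fun ω => ENNReal.log (Q.rnDeriv P ω)) =ᵐ[Q] fun ω => (llr Q P ω : EReal) := by
  filter_upwards [Measure.rnDeriv_pos h, h.ae_le (Q.rnDeriv_lt_top P)] with ω h1 h2
  rw [ENNReal.log_pos_real h1.ne' h2.ne, llr]

lemma relEntropy_eq_integral {Q P : Measure Ω} [SigmaFinite Q] [SigmaFinite P] (h : Q ≪ P)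
    (hi : Integrable (llr Q P) Q) : relEntropy Q P = ((∫ ω, llr Q P ω ∂Q : ℝ) : EReal) := by
  rw [relEntropy, if_pos h]
  exact eexpect_eq_integral hi (log_rnDeriv_ae h)

/-- `Q` has finite entropy relative to `P`. -/
def FiniteEntropy (Q P : Measure Ω) : Prop :=
  Q ≪ P ∧ Integrable (llr Q P) Q

lemma finiteEntropy_of_relEntropy_lt_top {Q P : Measure Ω} [IsFiniteMeasure Q]
    [IsFiniteMeasure P] (h : relEntropy Q P < ⊤) : FiniteEntropy Q P := by
  have hac : Q ≪ P := by
    by_contra hn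
    simp [relEntropy, hn] at h
  refine ⟨hac, (measurable_llr Q P).aestronglyMeasurable, ?_⟩
  rw [relEntropy, if_pos hac, eexpect] at h
  have h1 : ∫⁻ ω, (ENNReal.log (Q.rnDeriv P ω)).toENNReal ∂Q
      = ∫⁻ ω, ENNReal.ofReal (llr Q P ω) ∂Q :=
    lintegral_congr_ae ((log_rnDeriv_ae hac).mono fun ω hω => by simp [hω])
  have h2 : ∫⁻ ω, (-(ENNReal.log (Q.rnDeriv P ω))).toENNReal ∂Q
      = ∫⁻ ω, ENNReal.ofReal (-llr Q P ω) ∂Q :=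
    lintegral_congr_ae ((log_rnDeriv_ae hac).mono fun ω hω => by
      simp only [hω, ← EReal.coe_neg, EReal.toENNReal_of_ne_top (EReal.coe_ne_top _),
        EReal.toReal_coe])
  rw [h1, h2] at h
  -- The negative part is always integrable: `-llr ≤ exp (-llr) = dP/dQ`, whose integral is at most
  -- the mass of `P`.
  have hneg : ∫⁻ ω, ENNReal.ofReal (-llr Q P ω) ∂Q < ⊤ := by
    refine lt_of_le_of_lt (lintegral_mono_ae (g := P.rnDeriv Q) ?_)
      (lt_of_le_of_lt Measure.lintegral_rnDeriv_le (measure_lt_top P _))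
    filter_upwards [exp_neg_llr hac, P.rnDeriv_lt_top Q] with ω hω hlt
    rw [← ENNReal.ofReal_toReal hlt.ne, ← hω]
    exact ENNReal.ofReal_le_ofReal (by linarith [Real.add_one_le_exp (-llr Q P ω)])
  have hpos : ∫⁻ ω, ENNReal.ofReal (llr Q P ω) ∂Q < ⊤ := by
    rw [lt_top_iff_ne_top]
    intro htop
    rw [htop, ← EReal.coe_ennreal_toReal hneg.ne] at h
    simp at h
  refine lt_of_le_of_lt (lintegral_mono (g := fun ω => ENNReal.ofReal (llr Q P ω)
    + ENNReal.ofReal (-llr Q P ω)) fun ω => ?_) ?_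
  · rcases le_total 0 (llr Q P ω) with h0 | h0
    · simp [Real.enorm_eq_ofReal h0]
    · rw [← enorm_neg, Real.enorm_eq_ofReal (neg_nonneg.2 h0)]
      simp
  · rw [lintegral_add_left (by fun_prop)]
    exact ENNReal.add_lt_top.2 ⟨hpos, hneg⟩

lemma relEntropy_nonneg {Q P : Measure Ω} [IsProbabilityMeasure Q] [IsProbabilityMeasure P] :
    0 ≤ relEntropy Q P := by
  by_cases h : relEntropy Q P < ⊤
  · obtain ⟨h1, h2⟩ := finiteEntropy_of_relEntropy_lt_top h
    rw [relEntropy_eq_integral h1 h2]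
    have := InformationTheory.integral_llr_add_sub_measure_univ_nonneg h1 h2
    simp only [probReal_univ, add_sub_cancel_right] at this
    exact_mod_cast this
  · rw [not_lt_top_iff.1 h]
    exact le_top

/-! ### Mixtures -/

lemma toReal_rnDeriv_mix (Q P P' : Measure Ω) [IsFiniteMeasure Q] [IsFiniteMeasure P]
    [IsFiniteMeasure P'] (a b : ℝ≥0) :
    (fun ω => ((a • P + b • P').rnDeriv Q ω).toReal) =ᵐ[Q]
      fun ω => a * (P.rnDeriv Q ω).toReal + b * (P'.rnDeriv Q ω).toReal := by
  filter_upwards [Measure.rnDeriv_add (a • P) (b • P') Q, Measure.rnDeriv_smul_left P Q a,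
    Measure.rnDeriv_smul_left P' Q b, P.rnDeriv_lt_top Q, P'.rnDeriv_lt_top Q]
    with ω h1 h2 h3 h4 h5
  rw [h1, Pi.add_apply, h2, h3, Pi.smul_apply, Pi.smul_apply, ENNReal.smul_def, ENNReal.smul_def,
    smul_eq_mul, smul_eq_mul, ENNReal.toReal_add, ENNReal.toReal_mul, ENNReal.toReal_mul]
  · simp
  · exact ENNReal.mul_ne_top ENNReal.coe_ne_top h4.ne
  · exact ENNReal.mul_ne_top ENNReal.coe_ne_top h5.ne

/-- The likelihood ratio `dP'/dP`, computed from densities with respect to `Q`. -/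
noncomputable def likRatio (Q P P' : Measure Ω) (ω : Ω) : ℝ :=
  (P'.rnDeriv Q ω).toReal * Real.exp (llr Q P ω)

lemma likRatio_nonneg (Q P P' : Measure Ω) (ω : Ω) : 0 ≤ likRatio Q P P' ω := by
  unfold likRatio; positivity

@[fun_prop]
lemma measurable_likRatio (Q P P' : Measure Ω) : Measurable (likRatio Q P P') := by
  unfold likRatio
  exact (Measure.measurable_rnDeriv P' Q).ennreal_toReal.mul (measurable_llr Q P).exp

/-- Divide `dM/dQ = a dP/dQ + b dP'/dQ` by `dP/dQ`. Only `P` has to dominate `Q`, so `P'` may be any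
finite measure. -/
lemma llr_mix {Q P : Measure Ω} (P' : Measure Ω) [IsFiniteMeasure Q] [IsFiniteMeasure P]
    [IsFiniteMeasure P'] (h : Q ≪ P) {a b : ℝ≥0} (ha : 0 < a) :
    Q ≪ a • P + b • P' ∧ (fun ω => Real.log (a + b * likRatio Q P P' ω)) =ᵐ[Q]
      fun ω => llr Q P ω - llr Q (a • P + b • P') ω := by
  have hac : Q ≪ a • P + b • P' :=
    (h.trans (Measure.absolutelyContinuous_smul (ENNReal.coe_ne_zero.2 ha.ne'))).add_right _
  refine ⟨hac, ?_⟩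
  filter_upwards [toReal_rnDeriv_mix Q P P' a b, exp_neg_llr h, exp_neg_llr hac]
    with ω h1 h2 h3
  rw [← h3, ← h2] at h1
  have h4 : a + b * likRatio Q P P' ω
      = Real.exp (llr Q P ω - llr Q (a • P + b • P') ω) := by
    rw [sub_eq_add_neg, Real.exp_add, h1, likRatio, Real.exp_neg]
    have := (Real.exp_pos (llr Q P ω)).ne'
    field_simp
  rw [h4, Real.log_exp]

lemma integrable_llr_mix {Q P : Measure Ω} (P' : Measure Ω) [IsFiniteMeasure Q]
    [IsFiniteMeasure P] [IsFiniteMeasure P'] (h : FiniteEntropy Q P) {a b : ℝ≥0} (ha : 0 < a) :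
    FiniteEntropy Q (a • P + b • P') := by
  obtain ⟨hac, hlog⟩ := llr_mix (b := b) P' h.1 ha
  refine ⟨hac, ?_⟩
  set M := a • P + b • P'
  -- Above, `llr Q M ≤ llr Q P - log a` because `M ≥ a • P`; below, `llr Q M ≥ -dM/dQ`.
  have hb : Integrable (fun ω => |llr Q P ω| + |Real.log a| + (M.rnDeriv Q ω).toReal) Q :=
    (h.2.abs.add (integrable_const _)).add Measure.integrable_toReal_rnDeriv
  refine hb.mono' (measurable_llr _ _).aestronglyMeasurable ?_
  filter_upwards [hlog, exp_neg_llr hac] with ω h1 h2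
  have h3 : Real.log a ≤ Real.log (a + b * likRatio Q P P' ω) :=
    Real.log_le_log (by exact_mod_cast ha)
      (by have := likRatio_nonneg Q P P' ω; have := b.2; simp; positivity)
  rw [h1] at h3
  rw [← h2, Real.norm_eq_abs, abs_le]
  have := Real.add_one_le_exp (-llr Q M ω)
  have := le_abs_self (llr Q P ω)
  have := neg_abs_le (Real.log a)
  have := Real.exp_pos (-llr Q M ω)
  have := abs_nonneg (llr Q P ω)
  have := abs_nonneg (Real.log a)
  constructor <;> linarith

lemma integral_log_mix_le {Q P : Measure Ω} (P' : Measure Ω) [IsFiniteMeasure Q]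
    [IsFiniteMeasure P] [IsFiniteMeasure P'] (h : FiniteEntropy Q P) {a b : ℝ≥0} (ha : 0 < a)
    {c : ℝ} (hM : (c : EReal) ≤ relEntropy Q (a • P + b • P')) :
    Integrable (fun ω => Real.log (a + b * likRatio Q P P' ω)) Q ∧
      ∫ ω, Real.log (a + b * likRatio Q P P' ω) ∂Q ≤ ∫ ω, llr Q P ω ∂Q - c := by
  obtain ⟨hac, hlog⟩ := llr_mix (b := b) P' h.1 ha
  have hi := integrable_llr_mix (b := b) P' h ha
  refine ⟨(h.2.sub hi.2).congr hlog.symm, ?_⟩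
  rw [relEntropy_eq_integral hi.1 hi.2, EReal.coe_le_coe_iff] at hM
  rw [integral_congr_ae hlog, integral_sub h.2 hi.2]
  linarith

/-- Almost minimizers of the entropy have close log likelihood ratios. -/
lemma integral_abs_llr_sub_le {Q P P' : Measure Ω} [IsProbabilityMeasure Q]
    [IsFiniteMeasure P] [IsFiniteMeasure P'] (h : FiniteEntropy Q P) (h' : FiniteEntropy Q P')
    {c δ : ℝ} (hδ : 0 < δ)
    (hM : (c : EReal) ≤ relEntropy Q ((1 / 2 : ℝ≥0) • P + (1 / 2 : ℝ≥0) • P'))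
    (hP : ∫ ω, llr Q P ω ∂Q ≤ c + δ) (hP' : ∫ ω, llr Q P' ω ∂Q ≤ c + δ) :
    ∫ ω, |llr Q P ω - llr Q P' ω| ∂Q ≤ 2 * δ + 3 * √δ := by
  obtain ⟨hi, hle⟩ := integral_log_mix_le P' h (by norm_num) hM
  have hs : 0 < √δ := Real.sqrt_pos.2 hδ
  have hid : Integrable (fun ω => (llr Q P ω - llr Q P' ω) / 2) Q := (h.2.sub h'.2).div_const 2
  have hbound : ∀ᵐ ω ∂Q, |llr Q P ω - llr Q P' ω| ≤ (2 + 2 / √δ) *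
      (Real.log ((1 / 2 : ℝ≥0) + (1 / 2 : ℝ≥0) * likRatio Q P P' ω)
        - (llr Q P ω - llr Q P' ω) / 2) + √δ := by
    filter_upwards [exp_neg_llr h'.1] with ω hω
    have := abs_le_of_log_mix (llr Q P ω - llr Q P' ω) (√δ) hs
    have he : likRatio Q P P' ω = Real.exp (llr Q P ω - llr Q P' ω) := by
      rw [likRatio, ← hω, ← Real.exp_add]; ring_nf
    rw [he]
    simpa using this
  have h1 := integral_mono_ae (h.2.sub h'.2).abs
    (((hi.sub hid).const_mul (2 + 2 / √δ)).add (integrable_const (√δ))) hbound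
  refine h1.trans ?_
  have h2 : ∫ ω, ((2 + 2 / √δ) *
      (Real.log ((1 / 2 : ℝ≥0) + (1 / 2 : ℝ≥0) * likRatio Q P P' ω)
        - (llr Q P ω - llr Q P' ω) / 2) + √δ) ∂Q = (2 + 2 / √δ) *
      (∫ ω, Real.log ((1 / 2 : ℝ≥0) + (1 / 2 : ℝ≥0) * likRatio Q P P' ω) ∂Q
        - (∫ ω, llr Q P ω ∂Q - ∫ ω, llr Q P' ω ∂Q) / 2) + √δ := by
    have hi2 : Integrable (fun ω => Real.log ((1 / 2 : ℝ≥0) + (1 / 2 : ℝ≥0) *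
      likRatio Q P P' ω) - (llr Q P ω - llr Q P' ω) / 2) Q := hi.sub hid
    rw [integral_add (hi2.const_mul _) (integrable_const _), integral_const_mul,
      integral_sub hi hid, integral_div, integral_sub h.2 h'.2]
    simp
  refine h2.le.trans ?_
  -- The mean Jensen gap is at most the average of the two entropies minus `c`.
  have h3 : ∫ ω, Real.log ((1 / 2 : ℝ≥0) + (1 / 2 : ℝ≥0) * likRatio Q P P' ω) ∂Q
        - (∫ ω, llr Q P ω ∂Q - ∫ ω, llr Q P' ω ∂Q) / 2 ≤ δ := by linarith
  have h4 := mul_le_mul_of_nonneg_left h3 (show 0 ≤ 2 + 2 / √δ by positivity)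
  have h5 : (2 + 2 / √δ) * δ + √δ = 2 * δ + 3 * √δ := by
    have : δ / √δ = √δ := Real.div_sqrt
    have h6 : (2 + 2 / √δ) * δ = 2 * δ + 2 * (δ / √δ) := by ring
    rw [h6, this]; ring
  linarith

/-! ### The limit of the log likelihood ratios -/

/-- `f` is the limit of the log likelihood ratios along the sequence `P` in `H₀`, whose entropies
converge to `c`. -/
structure IsEntropyLimit (H₀ : Set (Measure Ω)) (Q : Measure Ω) (c : ℝ) (f : Ω → ℝ)
    (P : ℕ → Measure Ω) : Prop where
  measurable : Measurable f
  integrable : Integrable f Q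
  mem : ∀ n, P n ∈ H₀
  finiteEntropy : ∀ n, FiniteEntropy Q (P n)
  tendsto_entropy : Tendsto (fun n => ∫ ω, llr Q (P n) ω ∂Q) atTop (𝓝 c)
  tendsto_integral : Tendsto (fun n => ∫ ω, |llr Q (P n) ω - f ω| ∂Q) atTop (𝓝 0)
  tendsto_ae : ∀ᵐ ω ∂Q, Tendsto (fun n => llr Q (P n) ω) atTop (𝓝 (f ω))

variable {H₀ : Set (Measure Ω)} {Q : Measure Ω}

lemma mix_mem (h_conv : Convex ℝ≥0 H₀) {P P' : Measure Ω} (hP : P ∈ H₀) (hP' : P' ∈ H₀)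
    {a b : ℝ≥0} (hab : a + b = 1) : a • P + b • P' ∈ H₀ :=
  h_conv hP hP' zero_le zero_le hab

lemma tendsto_modulus : Tendsto (fun x : ℝ => 2 * x + 3 * √x) (𝓝 0) (𝓝 0) := by
  have : Continuous (fun x : ℝ => 2 * x + 3 * √x) := by fun_prop
  simpa using this.tendsto 0

/-- Completeness of `L¹(Q)`; the subsequence provides the pointwise convergence that Fatou's lemma
needs later. -/
lemma exists_integrable_limit {P : ℕ → Measure Ω} (hfin : ∀ n, FiniteEntropy Q (P n))
    {b : ℕ → ℝ} (hb : Tendsto b atTop (𝓝 0))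
    (hle : ∀ n m N, N ≤ n → N ≤ m → ∫ ω, |llr Q (P n) ω - llr Q (P m) ω| ∂Q ≤ b N) :
    ∃ f : Ω → ℝ, Measurable f ∧ Integrable f Q ∧
      Tendsto (fun n => ∫ ω, |llr Q (P n) ω - f ω| ∂Q) atTop (𝓝 0) ∧
      ∃ ns : ℕ → ℕ, StrictMono ns ∧
        ∀ᵐ ω ∂Q, Tendsto (fun n => llr Q (P (ns n)) ω) atTop (𝓝 (f ω)) := by
  let F : ℕ → Lp ℝ 1 Q := fun n => (hfin n).2.toL1 (llr Q (P n))
  have hF : ∀ n, F n =ᵐ[Q] llr Q (P n) := fun n => (hfin n).2.coeFn_toL1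
  have hcauchy : CauchySeq F := by
    refine cauchySeq_of_le_tendsto_0 b (fun n m N hn hm => ?_) hb
    rw [L1.dist_eq_integral_dist]
    refine le_of_eq_of_le (integral_congr_ae ?_) (hle n m N hn hm)
    filter_upwards [hF n, hF m] with ω h1 h2
    rw [h1, h2, Real.dist_eq]
  obtain ⟨G, hG⟩ := cauchySeq_tendsto_of_complete hcauchy
  refine ⟨G, (Lp.stronglyMeasurable G).measurable, L1.integrable_coeFn G, ?_, ?_⟩
  · refine (tendsto_iff_dist_tendsto_zero.1 hG).congr fun n => ?_
    rw [L1.dist_eq_integral_dist]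
    refine integral_congr_ae ?_
    filter_upwards [hF n] with ω h1
    rw [h1, Real.dist_eq]
  · obtain ⟨ns, hns, hlim⟩ := (tendstoInMeasure_of_tendsto_Lp hG).exists_seq_tendsto_ae
    refine ⟨ns, hns, ?_⟩
    filter_upwards [hlim, ae_all_iff.2 hF] with ω h1 h2
    exact h1.congr fun n => h2 (ns n)

lemma coe_le_relEntropy {c : ℝ} (hc : (⨅ P ∈ H₀, relEntropy Q P) = (c : EReal)) {P : Measure Ω}
    (hP : P ∈ H₀) : (c : EReal) ≤ relEntropy Q P :=
  hc.symm.le.trans (iInf₂_le P hP)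

lemma IsEntropyLimit.integral_eq {c : ℝ} {f : Ω → ℝ} {Pn : ℕ → Measure Ω}
    (hlim : IsEntropyLimit H₀ Q c f Pn) : ∫ ω, f ω ∂Q = c := by
  refine tendsto_nhds_unique ?_ hlim.tendsto_entropy
  rw [tendsto_iff_dist_tendsto_zero]
  refine squeeze_zero (fun _ => dist_nonneg) (fun n => ?_) hlim.tendsto_integral
  rw [Real.dist_eq, ← integral_sub (hlim.finiteEntropy n).2 hlim.integrable]
  exact abs_integral_le_integral_abs

section

variable [IsProbabilityMeasure Q] {c : ℝ} (h_prob : ∀ P ∈ H₀, IsProbabilityMeasure P)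
  (h_conv : Convex ℝ≥0 H₀) (hc : (⨅ P ∈ H₀, relEntropy Q P) = (c : EReal))

include h_prob hc in
lemma le_integral_llr {P : Measure Ω} (hP : P ∈ H₀) (hfin : FiniteEntropy Q P) :
    c ≤ ∫ ω, llr Q P ω ∂Q := by
  have := h_prob P hP
  have h := coe_le_relEntropy hc hP
  rwa [relEntropy_eq_integral hfin.1 hfin.2, EReal.coe_le_coe_iff] at h

include h_prob h_conv hc in
lemma integral_abs_llr_sub_le_of_mem {P P' : Measure Ω} (hP : P ∈ H₀) (hP' : P' ∈ H₀)
    (h : FiniteEntropy Q P) (h' : FiniteEntropy Q P') {δ : ℝ} (hδ : 0 < δ)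
    (hle : ∫ ω, llr Q P ω ∂Q ≤ c + δ) (hle' : ∫ ω, llr Q P' ω ∂Q ≤ c + δ) :
    ∫ ω, |llr Q P ω - llr Q P' ω| ∂Q ≤ 2 * δ + 3 * √δ := by
  have := h_prob P hP
  have := h_prob P' hP'
  exact integral_abs_llr_sub_le h h' hδ
    (coe_le_relEntropy hc (mix_mem h_conv hP hP' (by rw [← two_mul]; norm_num))) hle hle'

include h_prob hc in
lemma exists_almost_minimizer {δ : ℝ} (hδ : 0 < δ) :
    ∃ P ∈ H₀, FiniteEntropy Q P ∧ ∫ ω, llr Q P ω ∂Q ≤ c + δ := by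
  have h : (⨅ P ∈ H₀, relEntropy Q P) < ((c + δ : ℝ) : EReal) := by
    rw [hc, EReal.coe_lt_coe_iff]; linarith
  obtain ⟨P, hP, hlt⟩ := by simpa only [iInf_lt_iff] using h
  have := h_prob P hP
  have hfin := finiteEntropy_of_relEntropy_lt_top (hlt.trans (EReal.coe_lt_top _))
  rw [relEntropy_eq_integral hfin.1 hfin.2, EReal.coe_lt_coe_iff] at hlt
  exact ⟨P, hP, hfin, hlt.le⟩

include h_prob h_conv hc in
lemma exists_isEntropyLimit : ∃ f P, IsEntropyLimit H₀ Q c f P := by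
  have hδ : ∀ n : ℕ, 0 < 1 / ((n : ℝ) + 1) := fun n => Nat.one_div_pos_of_nat
  choose P hP hfin hle using fun n => exists_almost_minimizer h_prob hc (hδ n)
  have hb := tendsto_modulus.comp (tendsto_one_div_add_atTop_nhds_zero_nat (𝕜 := ℝ))
  obtain ⟨f, hf, hfi, hL1, ns, hns, hae⟩ := exists_integrable_limit hfin hb
    fun n m N hn hm => integral_abs_llr_sub_le_of_mem h_prob h_conv hc (hP n) (hP m) (hfin n)
      (hfin m) (hδ N)
      ((hle n).trans (add_le_add_right (Nat.one_div_le_one_div hn) c))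
      ((hle m).trans (add_le_add_right (Nat.one_div_le_one_div hm) c))
  have hent : Tendsto (fun n => ∫ ω, llr Q (P n) ω ∂Q) atTop (𝓝 c) := by
    refine tendsto_of_tendsto_of_tendsto_of_le_of_le tendsto_const_nhds
      (by simpa using (tendsto_one_div_add_atTop_nhds_zero_nat (𝕜 := ℝ)).const_add c)
      (fun n => le_integral_llr h_prob hc (hP n) (hfin n)) hle
  exact ⟨f, P ∘ ns, hf, hfi, fun n => hP _, fun n => hfin _, hent.comp hns.tendsto_atTop,
    hL1.comp hns.tendsto_atTop, hae⟩

variable {f : Ω → ℝ} {Pn : ℕ → Measure Ω} (hlim : IsEntropyLimit H₀ Q c f Pn)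

-- The estimate for two near-minimizers, with the second sent to the limit along `Pn`. The bound
-- does not involve `Pn`, so every minimizing sequence has limit `f`.
include h_prob h_conv hc hlim in
lemma IsEntropyLimit.integral_abs_sub_le {P : Measure Ω} (hP : P ∈ H₀) (hfin : FiniteEntropy Q P)
    {δ : ℝ} (hδ : 0 < δ) (hle : ∫ ω, llr Q P ω ∂Q ≤ c + δ) :
    ∫ ω, |llr Q P ω - f ω| ∂Q ≤ 2 * δ + 3 * √δ := by
  have h1 : Tendsto (fun n => (2 * δ + 3 * √δ) + ∫ ω, |llr Q (Pn n) ω - f ω| ∂Q) atTop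
      (𝓝 (2 * δ + 3 * √δ)) := by
    simpa using hlim.tendsto_integral.const_add (2 * δ + 3 * √δ)
  refine ge_of_tendsto h1 ?_
  filter_upwards [hlim.tendsto_entropy.eventually_le_const (show c < c + δ by linarith)]
    with n hn
  have hn' := hlim.finiteEntropy n
  have h2 := integral_abs_llr_sub_le_of_mem h_prob h_conv hc hP (hlim.mem n) hfin hn' hδ hle hn
  have h3 : ∫ ω, |llr Q P ω - f ω| ∂Q
      ≤ ∫ ω, (|llr Q P ω - llr Q (Pn n) ω| + |llr Q (Pn n) ω - f ω|) ∂Q :=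
    integral_mono (hfin.2.sub hlim.integrable).abs
      ((hfin.2.sub hn'.2).abs.add (hn'.2.sub hlim.integrable).abs)
      fun ω => abs_sub_le _ _ _
  have h4 : ∫ ω, (|llr Q P ω - llr Q (Pn n) ω| + |llr Q (Pn n) ω - f ω|) ∂Q
      = ∫ ω, |llr Q P ω - llr Q (Pn n) ω| ∂Q + ∫ ω, |llr Q (Pn n) ω - f ω| ∂Q :=
    integral_add (hfin.2.sub hn'.2).abs (hn'.2.sub hlim.integrable).abs
  linarith

end

/-! ### The limit is a numeraire -/

lemma lintegral_le_of_ae_tendsto {F : ℕ → Ω → ℝ≥0∞} {G : Ω → ℝ≥0∞} {b : ℕ → ℝ≥0∞} {B : ℝ≥0∞}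
    (hF : ∀ n, Measurable (F n)) (hlim : ∀ᵐ ω ∂Q, Tendsto (fun n => F n ω) atTop (𝓝 (G ω)))
    (hle : ∀ n, ∫⁻ ω, F n ω ∂Q ≤ b n) (hb : Tendsto b atTop (𝓝 B)) :
    ∫⁻ ω, G ω ∂Q ≤ B := by
  calc ∫⁻ ω, G ω ∂Q = ∫⁻ ω, liminf (fun n => F n ω) atTop ∂Q :=
        lintegral_congr_ae (hlim.mono fun ω h => h.liminf_eq.symm)
    _ ≤ liminf (fun n => ∫⁻ ω, F n ω ∂Q) atTop := lintegral_liminf_le hF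
    _ ≤ liminf b atTop := liminf_le_liminf (Eventually.of_forall hle)
    _ = B := hb.liminf_eq

/-- Only an inequality, since the left side drops the part of `P` singular to `Q`. -/
lemma lintegral_mul_rnDeriv_le {P : Measure Ω} {X : Ω → ℝ≥0∞}
    (hX : Measurable X) : ∫⁻ ω, P.rnDeriv Q ω * X ω ∂Q ≤ ∫⁻ ω, X ω ∂P := by
  have h := lintegral_withDensity_eq_lintegral_mul Q (Measure.measurable_rnDeriv P Q) hX
  simp only [Pi.mul_apply] at h
  rw [← h]
  exact lintegral_mono' (Measure.withDensity_rnDeriv_le P Q) le_rfl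

/-- The normalised likelihood ratio has expectation at most `1 + ε / b` when the entropy of the
mixture `a • P + b • P'` does not drop by more than `ε`. -/
lemma lintegral_ratio_mix_le [IsProbabilityMeasure Q] {P : Measure Ω} (P' : Measure Ω)
    [IsFiniteMeasure P] [IsFiniteMeasure P'] (h : FiniteEntropy Q P) {a b : ℝ≥0} (ha : 0 < a)
    (hb : 0 < b) (hab : a + b = 1) {c : ℝ} (hM : (c : EReal) ≤ relEntropy Q (a • P + b • P'))
    {ε : ℝ} (hε : 0 ≤ ε) (hle : ∫ ω, llr Q P ω ∂Q ≤ c + ε) :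
    ∫⁻ ω, ENNReal.ofReal (likRatio Q P P' ω / (a + b * likRatio Q P P' ω)) ∂Q
      ≤ ENNReal.ofReal (1 + ε / b) := by
  obtain ⟨hi, hint⟩ := integral_log_mix_le P' h ha hM
  have ha' : (0 : ℝ) < a := ha
  have hb' : (0 : ℝ) < b := hb
  have hab' : (a : ℝ) + b = 1 := by exact_mod_cast hab
  -- With `y = a + b r` and `a + b = 1`, `r / y = 1 + (a / b)(1 - 1 / y)`; then use `1 - 1 / y ≤ log
  -- y`.
  have hpt : ∀ ω, likRatio Q P P' ω / (a + b * likRatio Q P P' ω)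
      ≤ 1 + a / b * Real.log (a + b * likRatio Q P P' ω) := by
    intro ω
    have hr := likRatio_nonneg Q P P' ω
    set r := likRatio Q P P' ω
    have hy : 0 < a + b * r := by positivity
    have hlog := Real.one_sub_inv_le_log_of_pos hy
    have h1 : r / (a + b * r) = 1 + a / b * (1 - (a + b * r)⁻¹) := by
      field_simp
      linear_combination -(a + b * r) * hab'
    rw [h1]
    have : 0 ≤ (a : ℝ) / b := by positivity
    nlinarith
  have hint' : Integrable (fun ω => 1 + a / b * Real.log (a + b * likRatio Q P P' ω)) Q :=
    (integrable_const _).add (hi.const_mul _)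
  have hnn : 0 ≤ fun ω => 1 + a / b * Real.log (a + b * likRatio Q P P' ω) := fun ω =>
    (div_nonneg (likRatio_nonneg Q P P' ω)
      (by have := likRatio_nonneg Q P P' ω; positivity)).trans (hpt ω)
  refine (lintegral_mono fun ω => ENNReal.ofReal_le_ofReal (hpt ω)).trans ?_
  rw [← ofReal_integral_eq_lintegral_ofReal hint' (ae_of_all _ hnn)]
  apply ENNReal.ofReal_le_ofReal
  rw [integral_add (integrable_const _) (hi.const_mul _), integral_const_mul]
  have h2 : ∫ ω, Real.log (a + b * likRatio Q P P' ω) ∂Q ≤ ε := by linarith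
  have h3 : (a : ℝ) / b * ∫ ω, Real.log (a + b * likRatio Q P P' ω) ∂Q ≤ a / b * ε :=
    mul_le_mul_of_nonneg_left h2 (by positivity)
  have h4 : (a : ℝ) / b * ε ≤ ε / b := by
    rw [div_mul_eq_mul_div]
    gcongr
    nlinarith
  simp only [integral_const, probReal_univ, one_smul]
  linarith

section

variable [IsProbabilityMeasure Q] {c : ℝ} (h_prob : ∀ P ∈ H₀, IsProbabilityMeasure P)
  (h_conv : Convex ℝ≥0 H₀) (hc : (⨅ P ∈ H₀, relEntropy Q P) = (c : EReal))
  {f : Ω → ℝ} {Pn : ℕ → Measure Ω} (hlim : IsEntropyLimit H₀ Q c f Pn)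

include h_prob h_conv hc hlim in
lemma IsEntropyLimit.lintegral_rnDeriv_mul_exp_le {P : Measure Ω} (hP : P ∈ H₀) :
    ∫⁻ ω, P.rnDeriv Q ω * ENNReal.ofReal (Real.exp (f ω)) ∂Q ≤ 1 := by
  have := h_prob P hP
  -- The shift by 2 keeps both weights positive. The index `φ k` is taken so that the entropy excess
  -- is at most `b k ^ 2`; the error `ε / b` is then `b k`, which vanishes.
  let b : ℕ → ℝ≥0 := fun k => 1 / ((k : ℝ≥0) + 2)
  let a : ℕ → ℝ≥0 := fun k => 1 - b k
  have hb : ∀ k, 0 < b k := fun k => by positivity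
  have hb1 : ∀ k, b k < 1 := fun k => by
    simp only [b]
    rw [div_lt_one (by positivity)]
    exact lt_of_lt_of_le one_lt_two le_add_self
  have hab : ∀ k, a k + b k = 1 := fun k => tsub_add_cancel_of_le (hb1 k).le
  have ha : ∀ k, 0 < a k := fun k => tsub_pos_of_lt (hb1 k)
  have hblim : Tendsto (fun k => (b k : ℝ)) atTop (𝓝 0) := by
    have h := (tendsto_one_div_add_atTop_nhds_zero_nat (𝕜 := ℝ)).comp (tendsto_add_atTop_nat 1)
    refine h.congr fun k => ?_
    simp only [b, Function.comp]
    push_cast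
    ring_nf
  have halim : Tendsto (fun k => (a k : ℝ)) atTop (𝓝 1) := by
    have h : ∀ k, (a k : ℝ) = 1 - b k := fun k => NNReal.coe_sub (hb1 k).le
    simp only [h]
    simpa using hblim.const_sub 1
  obtain ⟨φ, hφ, hle⟩ := extraction_forall_of_eventually'
    (P := fun k n => ∫ ω, llr Q (Pn n) ω ∂Q ≤ c + (b k : ℝ) * b k) fun k => by
      have hk : 0 < (b k : ℝ) := hb k
      exact eventually_atTop.1 (hlim.tendsto_entropy.eventually_le_const
        (show c < c + (b k : ℝ) * b k by nlinarith))
  refine lintegral_le_of_ae_tendsto (F := fun k ω => ENNReal.ofReal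
      (likRatio Q (Pn (φ k)) P ω / (a k + b k * likRatio Q (Pn (φ k)) P ω)))
    (b := fun k => ENNReal.ofReal (1 + (b k : ℝ) * b k / b k)) (fun k => by fun_prop) ?_ ?_ ?_
  · filter_upwards [hlim.tendsto_ae, P.rnDeriv_lt_top Q] with ω hω hlt
    have h1 : Tendsto (fun k => likRatio Q (Pn (φ k)) P ω) atTop
        (𝓝 ((P.rnDeriv Q ω).toReal * Real.exp (f ω))) :=
      ((Real.continuous_exp.tendsto _).comp (hω.comp hφ.tendsto_atTop)).const_mul _
    have h2 := h1.div (halim.add (hblim.mul h1)) (by simp)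
    have h3 := (ENNReal.continuous_ofReal.tendsto _).comp h2
    have h4 : ENNReal.ofReal ((P.rnDeriv Q ω).toReal * Real.exp (f ω) /
        (1 + 0 * ((P.rnDeriv Q ω).toReal * Real.exp (f ω))))
        = P.rnDeriv Q ω * ENNReal.ofReal (Real.exp (f ω)) := by
      rw [zero_mul, add_zero, div_one, ENNReal.ofReal_mul ENNReal.toReal_nonneg,
        ENNReal.ofReal_toReal hlt.ne]
    rw [h4] at h3
    exact h3
  · intro k
    have := h_prob _ (hlim.mem (φ k))
    exact lintegral_ratio_mix_le P (hlim.finiteEntropy (φ k)) (ha k) (hb k) (hab k)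
      (coe_le_relEntropy hc (mix_mem h_conv (hlim.mem (φ k)) hP (hab k))) (by positivity) (hle k)
  · have h1 : ∀ k, (b k : ℝ) * b k / b k = b k := fun k => by
      have : (b k : ℝ) ≠ 0 := NNReal.coe_ne_zero.2 (hb k).ne'
      field_simp
    simp only [h1]
    have h2 := (ENNReal.continuous_ofReal.tendsto _).comp (hblim.const_add 1)
    rwa [add_zero, ENNReal.ofReal_one] at h2

/-- The function `exp f`, cut off outside of the support of `dQ/dμ`. -/
noncomputable def expOnSupport (Q μ : Measure Ω) (f : Ω → ℝ) : Ω → ℝ≥0∞ :=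
  {ω | Q.rnDeriv μ ω ≠ 0}.indicator fun ω => ENNReal.ofReal (Real.exp (f ω))

lemma measurableSet_rnDeriv_ne_zero (Q μ : Measure Ω) :
    MeasurableSet {ω | Q.rnDeriv μ ω ≠ 0} :=
  (measurableSet_eq_fun (Measure.measurable_rnDeriv Q μ) measurable_const).compl

lemma measurable_expOnSupport (Q μ : Measure Ω) (hf : Measurable f) :
    Measurable (expOnSupport Q μ f) :=
  (hf.exp.ennreal_ofReal).indicator (measurableSet_rnDeriv_ne_zero Q μ)

lemma expOnSupport_ae {μ : Measure Ω} [IsFiniteMeasure μ] (hQ : Q ≪ μ) (f : Ω → ℝ) :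
    expOnSupport Q μ f =ᵐ[Q] fun ω => ENNReal.ofReal (Real.exp (f ω)) := by
  filter_upwards [Measure.rnDeriv_pos hQ] with ω hω
  exact Set.indicator_of_mem (show ω ∈ {ω | Q.rnDeriv μ ω ≠ 0} from hω.ne') _

/-- On the set where `dQ/dμ` is nonzero, a `Q`-null set is `μ`-null. Elements of `H₀` may charge
`Q`-null sets, where `f` is arbitrary; the cut-off confines them to this set, on which they are
dominated by `Q`. -/
lemma restrict_rnDeriv_ne_zero_absolutelyContinuous {μ : Measure Ω} [IsFiniteMeasure μ]
    (hQ : Q ≪ μ) : μ.restrict {ω | Q.rnDeriv μ ω ≠ 0} ≪ Q := by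
  refine Measure.AbsolutelyContinuous.mk fun A hA h0 => ?_
  rw [← Measure.withDensity_rnDeriv_eq Q μ hQ,
    withDensity_apply_eq_zero (Measure.measurable_rnDeriv Q μ)] at h0
  rwa [Measure.restrict_apply hA, Set.inter_comm]

include h_prob h_conv hc hlim in
lemma IsEntropyLimit.isEVariable {μ : Measure Ω} [IsFiniteMeasure μ] (hQ : Q ≪ μ)
    (h_dom : ∀ P ∈ H₀, P ≪ μ) : IsEVariable H₀ (expOnSupport Q μ f) := by
  refine ⟨measurable_expOnSupport Q μ hlim.measurable, fun P hP => ?_⟩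
  have := h_prob P hP
  have hS := measurableSet_rnDeriv_ne_zero Q μ
  set S := {ω | Q.rnDeriv μ ω ≠ 0}
  have hac : P.restrict S ≪ Q :=
    ((h_dom P hP).restrict S).trans (restrict_rnDeriv_ne_zero_absolutelyContinuous hQ)
  have hm : Measurable fun ω => ENNReal.ofReal (Real.exp (f ω)) :=
    hlim.measurable.exp.ennreal_ofReal
  calc ∫⁻ ω, expOnSupport Q μ f ω ∂P
      = ∫⁻ ω, ENNReal.ofReal (Real.exp (f ω)) ∂(P.restrict S) := lintegral_indicator hS _
    _ = ∫⁻ ω, (P.restrict S).rnDeriv Q ω * ENNReal.ofReal (Real.exp (f ω)) ∂Q :=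
        (lintegral_rnDeriv_mul hac hm.aemeasurable).symm
    _ ≤ ∫⁻ ω, P.rnDeriv Q ω * ENNReal.ofReal (Real.exp (f ω)) ∂Q := by
        refine lintegral_mono_ae ?_
        filter_upwards [Measure.rnDeriv_restrict P Q hS] with ω hω
        rw [hω]
        gcongr
        exact Set.indicator_le_self _ _ _
    _ ≤ 1 := hlim.lintegral_rnDeriv_mul_exp_le h_prob h_conv hc hP

include h_prob hlim in
lemma IsEntropyLimit.lintegral_mul_exp_neg_le {X : Ω → ℝ≥0∞} (hX : IsEVariable H₀ X) :
    ∫⁻ ω, ENNReal.ofReal (Real.exp (-f ω)) * X ω ∂Q ≤ 1 := by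
  have hfinP : ∀ n, IsProbabilityMeasure (Pn n) := fun n => h_prob _ (hlim.mem n)
  have hXtop : ∀ᵐ ω ∂Q, X ω < ⊤ := by
    have h := (hX.2 (Pn 0) (hlim.mem 0)).trans_lt ENNReal.one_lt_top
    exact (hlim.finiteEntropy 0).1.ae_le (ae_lt_top hX.1 h.ne)
  refine lintegral_le_of_ae_tendsto
    (F := fun n ω => ENNReal.ofReal (Real.exp (-llr Q (Pn n) ω)) * X ω) (b := fun _ => 1)
    (fun n => ((measurable_llr _ _).neg.exp.ennreal_ofReal).mul hX.1) ?_ (fun n => ?_)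
    tendsto_const_nhds
  · filter_upwards [hlim.tendsto_ae, hXtop] with ω hω hlt
    have h1 := (ENNReal.continuous_ofReal.tendsto _).comp
      ((Real.continuous_exp.tendsto _).comp hω.neg)
    exact ENNReal.Tendsto.mul_const h1 (Or.inr hlt.ne)
  · refine le_of_eq_of_le (lintegral_congr_ae ?_)
      ((lintegral_mul_rnDeriv_le hX.1).trans (hX.2 (Pn n) (hlim.mem n)))
    filter_upwards [exp_neg_llr (hlim.finiteEntropy n).1, (Pn n).rnDeriv_lt_top Q] with ω h1 h2
    simp only [h1, ENNReal.ofReal_toReal h2.ne]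

include h_prob h_conv hc hlim in
lemma IsEntropyLimit.isNumeraire {μ : Measure Ω} [IsFiniteMeasure μ] (hQ : Q ≪ μ)
    (h_dom : ∀ P ∈ H₀, P ≪ μ) : IsNumeraire H₀ Q (expOnSupport Q μ f) := by
  refine ⟨hlim.isEVariable h_prob h_conv hc hQ h_dom, ?_, fun X hX => ?_⟩
  · filter_upwards [expOnSupport_ae hQ f] with ω hω
    rw [hω]
    exact ENNReal.ofReal_pos.2 (Real.exp_pos _)
  · refine le_of_eq_of_le (lintegral_congr_ae ?_) (hlim.lintegral_mul_exp_neg_le h_prob hX)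
    filter_upwards [expOnSupport_ae hQ f] with ω hω
    rw [hω, ratio, if_neg (by simp), Real.exp_neg, ENNReal.ofReal_inv_of_pos (Real.exp_pos _),
      div_eq_mul_inv, mul_comm]

end

/-! ### Uniqueness of the numeraire -/

lemma two_le_add_inv_and_eq_one {u : ℝ≥0∞} (h0 : u ≠ 0) (ht : u ≠ ⊤) :
    2 ≤ u + u⁻¹ ∧ (u + u⁻¹ = 2 → u = 1) := by
  lift u to ℝ≥0 using ht
  have h0' : u ≠ 0 := by exact_mod_cast h0
  have hpos : (0 : ℝ) < u := by positivity
  have key : (u : ℝ) + (u : ℝ)⁻¹ - 2 = (u - 1) ^ 2 / u := by field_simp; ring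
  rw [← ENNReal.coe_inv h0']
  constructor
  · have : (2 : ℝ) ≤ u + (u : ℝ)⁻¹ := by
      have : 0 ≤ ((u : ℝ) - 1) ^ 2 / u := by positivity
      linarith
    exact_mod_cast this
  · intro h
    have h' : (u : ℝ) + (u : ℝ)⁻¹ = 2 := by exact_mod_cast h
    rw [h', sub_self, eq_comm, div_eq_zero_iff, sq_eq_zero_iff] at key
    rcases key with h1 | h1
    · have h2 : (u : ℝ) = 1 := by linarith
      exact_mod_cast h2
    · exact absurd h1 hpos.ne'

lemma IsEVariable.ae_lt_top {X : Ω → ℝ≥0∞} (hX : IsEVariable H₀ X) {P : Measure Ω} (hP : P ∈ H₀)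
    (hQP : Q ≪ P) : ∀ᵐ ω ∂Q, X ω < ⊤ :=
  hQP.ae_le (MeasureTheory.ae_lt_top hX.1 ((hX.2 P hP).trans_lt ENNReal.one_lt_top).ne)

lemma IsNumeraire.ae_eq [IsProbabilityMeasure Q] {X Y : Ω → ℝ≥0∞} (hX : IsNumeraire H₀ Q X)
    (hY : IsNumeraire H₀ Q Y) {P : Measure Ω} (hP : P ∈ H₀) (hQP : Q ≪ P) : X =ᵐ[Q] Y := by
  have hXt := hX.1.ae_lt_top hP hQP
  have hYt := hY.1.ae_lt_top hP hQP
  have hmeas : Measurable fun ω => X ω / Y ω := hX.1.1.div hY.1.1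
  have h1 : ∫⁻ ω, X ω / Y ω ∂Q ≤ 1 := by
    refine le_of_eq_of_le (lintegral_congr_ae ?_) (hY.2.2 X hX.1)
    filter_upwards [hXt] with ω hω
    rw [ratio, if_neg fun h => hω.ne h.1]
  have h2 : ∫⁻ ω, (X ω / Y ω)⁻¹ ∂Q ≤ 1 := by
    refine le_of_eq_of_le (lintegral_congr_ae ?_) (hX.2.2 Y hY.1)
    filter_upwards [hYt, hX.2.1, hY.2.1] with ω hω h3 h4
    rw [ratio, if_neg fun h => hω.ne h.1, ENNReal.inv_div (Or.inl hω.ne) (Or.inl h4.ne')]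
  have hprop : ∀ᵐ ω ∂Q, X ω / Y ω ≠ 0 ∧ X ω / Y ω ≠ ⊤ := by
    filter_upwards [hXt, hYt, hX.2.1, hY.2.1] with ω h3 h4 h5 h6
    exact ⟨(ENNReal.div_pos h5.ne' h4.ne).ne', ENNReal.div_ne_top h3.ne h6.ne'⟩
  -- The sum is at least 2 pointwise and has mean at most 2, hence equals 2 almost surely.
  have h3 : (fun _ => (2 : ℝ≥0∞)) =ᵐ[Q] fun ω => X ω / Y ω + (X ω / Y ω)⁻¹ := by
    have hconst : ∫⁻ _, (2 : ℝ≥0∞) ∂Q = 2 := by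
      rw [lintegral_const, measure_univ, mul_one]
    refine ae_eq_of_ae_le_of_lintegral_le (f := fun _ => (2 : ℝ≥0∞))
      (g := fun ω => X ω / Y ω + (X ω / Y ω)⁻¹) ?_ (by rw [hconst]; exact ENNReal.ofNat_ne_top)
      (hmeas.add hmeas.inv).aemeasurable ?_
    · filter_upwards [hprop] with ω hω
      exact (two_le_add_inv_and_eq_one hω.1 hω.2).1
    · rw [lintegral_add_left hmeas, hconst, ← one_add_one_eq_two]
      exact add_le_add h1 h2
  filter_upwards [h3, hprop, hYt, hY.2.1] with ω h4 h5 h6 h7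
  have h8 := (two_le_add_inv_and_eq_one h5.1 h5.2).2 h4.symm
  rwa [ENNReal.div_eq_one_iff h7.ne' h6.ne] at h8

/-! ### Densities -/

/-- The chain rule `dQ/dμ = dQ/dR · dR/dμ`. -/
lemma rnDeriv_eq_exp_llr {R μ : Measure Ω} [IsFiniteMeasure Q] [IsFiniteMeasure R]
    [IsFiniteMeasure μ] (hQR : Q ≪ R) (hRμ : R ≪ μ) : R.rnDeriv μ =ᵐ[Q]
      fun ω => ENNReal.ofReal (Real.exp (llr Q μ ω - llr Q R ω)) := by
  have hQμ := hQR.trans hRμ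
  filter_upwards [hQμ.ae_le (Measure.rnDeriv_mul_rnDeriv (κ := μ) hQR),
    hQμ.ae_le (R.rnDeriv_lt_top μ), exp_llr_of_ac Q R hQR, exp_llr_of_ac Q μ hQμ] with ω h1 h2 h3 h4
  rw [Pi.mul_apply] at h1
  rw [Real.exp_sub, h3, h4, ← h1, ENNReal.toReal_mul, ← h3,
    mul_div_cancel_left₀ _ (Real.exp_pos _).ne', ENNReal.ofReal_toReal h2.ne]

/-- The distance of the logarithms of two densities that are positive and finite almost surely. -/
lemma logL1Dist_ofReal_exp {p q : Ω → ℝ≥0∞} {u v : Ω → ℝ}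
    (hp : p =ᵐ[Q] fun ω => ENNReal.ofReal (Real.exp (u ω)))
    (hq : q =ᵐ[Q] fun ω => ENNReal.ofReal (Real.exp (v ω))) :
    logL1Dist Q p q = ∫⁻ ω, ENNReal.ofReal |u ω - v ω| ∂Q := by
  refine lintegral_congr_ae ?_
  filter_upwards [hp, hq] with ω h1 h2
  rw [h1, h2, ENNReal.log_ofReal_of_pos (Real.exp_pos _),
    ENNReal.log_ofReal_of_pos (Real.exp_pos _), Real.log_exp, Real.log_exp, ← EReal.coe_sub,
    EReal.abs_def]

@[fun_prop]
lemma measurable_ereal_abs : Measurable EReal.abs :=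
  EReal.measurable_of_measurable_real (by
    simp only [EReal.abs_def]
    fun_prop)

lemma measurable_abs_log_sub_log {p q : Ω → ℝ≥0∞} (hp : Measurable p) (hq : Measurable q) :
    Measurable fun ω => (ENNReal.log (p ω) - ENNReal.log (q ω)).abs := by
  simp only [sub_eq_add_neg]
  exact measurable_ereal_abs.comp ((ENNReal.measurable_log.comp hp).add
    (continuous_neg.measurable.comp (ENNReal.measurable_log.comp hq)))

/-- If `x` or `y` is infinite, the right side is `∞`; otherwise this is the real triangle
inequality. -/
lemma ereal_abs_sub_coe_le (x y : EReal) (r : ℝ) :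
    (x - r).abs ≤ (y - x).abs + (y - r).abs := by
  induction y with
  | bot => simp
  | top => simp
  | coe y =>
    induction x with
    | bot => simp
    | top => simp
    | coe x =>
      simp only [← EReal.coe_sub, EReal.abs_def]
      rw [← ENNReal.ofReal_add (abs_nonneg _) (abs_nonneg _), abs_sub_comm y x]
      exact ENNReal.ofReal_le_ofReal (abs_sub_le x y r)

lemma ereal_eq_of_abs_sub_coe_eq_zero {x : EReal} {r : ℝ} (h : (x - r).abs = 0) : x = r := by
  rw [EReal.abs_eq_zero_iff] at h
  induction x with
  | bot => simp at h
  | top => simp at h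
  | coe x =>
    rw [← EReal.coe_sub, EReal.coe_eq_zero, sub_eq_zero] at h
    rw [h]

/-- A positive and finite limit for `logL1Dist` is almost surely unique. -/
lemma ae_eq_of_tendsto_logL1Dist {p : ℕ → Ω → ℝ≥0∞} {g q : Ω → ℝ≥0∞} {v : Ω → ℝ}
    (hp : ∀ n, Measurable (p n)) (hg : Measurable g) (hq : Measurable q)
    (hqv : q =ᵐ[Q] fun ω => ENNReal.ofReal (Real.exp (v ω)))
    (h1 : Tendsto (fun n => logL1Dist Q (p n) g) atTop (𝓝 0))
    (h2 : Tendsto (fun n => logL1Dist Q (p n) q) atTop (𝓝 0)) : g =ᵐ[Q] q := by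
  have hlog : ∀ᵐ ω ∂Q, ENNReal.log (q ω) = (v ω : EReal) := by
    filter_upwards [hqv] with ω hω
    rw [hω, ENNReal.log_ofReal_of_pos (Real.exp_pos _), Real.log_exp]
  have hle : ∀ n, logL1Dist Q g q ≤ logL1Dist Q (p n) g + logL1Dist Q (p n) q := by
    intro n
    rw [logL1Dist, logL1Dist, logL1Dist,
      ← lintegral_add_left (measurable_abs_log_sub_log (hp n) hg)]
    refine lintegral_mono_ae ?_
    filter_upwards [hlog] with ω hω
    rw [hω]
    exact ereal_abs_sub_coe_le _ _ _
  have h0 : logL1Dist Q g q = 0 := by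
    have h3 := h1.add h2
    rw [add_zero] at h3
    exact le_antisymm (ge_of_tendsto' h3 hle) zero_le
  rw [logL1Dist, lintegral_eq_zero_iff (measurable_abs_log_sub_log hg hq)] at h0
  filter_upwards [h0, hlog] with ω h4 h5
  refine ENNReal.log_injective ?_
  rw [h5] at h4 ⊢
  exact ereal_eq_of_abs_sub_coe_eq_zero h4

/-! ### The projection -/

/-- The measure with density `exp (-f)` with respect to `Q`. -/
noncomputable def expNegMeasure (Q : Measure Ω) (f : Ω → ℝ) : Measure Ω :=
  Q.withDensity fun ω => ENNReal.ofReal (Real.exp (-f ω))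

lemma expNegMeasure_absolutelyContinuous (f : Ω → ℝ) : expNegMeasure Q f ≪ Q :=
  withDensity_absolutelyContinuous _ _

lemma absolutelyContinuous_expNegMeasure {f : Ω → ℝ} (hf : Measurable f) :
    Q ≪ expNegMeasure Q f :=
  withDensity_absolutelyContinuous' hf.neg.exp.ennreal_ofReal.aemeasurable
    (ae_of_all _ fun _ => (ENNReal.ofReal_pos.2 (Real.exp_pos _)).ne')

lemma llr_expNegMeasure [IsFiniteMeasure Q] {f : Ω → ℝ} (hf : Measurable f)
    [IsFiniteMeasure (expNegMeasure Q f)] : llr Q (expNegMeasure Q f) =ᵐ[Q] f := by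
  filter_upwards [exp_neg_llr (absolutelyContinuous_expNegMeasure (Q := Q) hf),
    Measure.rnDeriv_withDensity Q hf.neg.exp.ennreal_ofReal] with ω h1 h2
  have h3 : ((expNegMeasure Q f).rnDeriv Q ω).toReal = Real.exp (-f ω) := by
    rw [expNegMeasure]
    exact (congrArg ENNReal.toReal h2).trans (ENNReal.toReal_ofReal (Real.exp_pos _).le)
  rw [h3, Real.exp_eq_exp] at h1
  linarith

lemma withDensity_inv_expOnSupport {μ : Measure Ω} [IsProbabilityMeasure Q] [IsFiniteMeasure μ]
    (hQ : Q ≪ μ) (f : Ω → ℝ) :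
    Q.withDensity (fun ω => (expOnSupport Q μ f ω)⁻¹) = expNegMeasure Q f := by
  refine withDensity_congr_ae ?_
  filter_upwards [expOnSupport_ae hQ f] with ω hω
  rw [hω, Real.exp_neg, ENNReal.ofReal_inv_of_pos (Real.exp_pos _)]

lemma IsReverseInfoProj.eq [IsProbabilityMeasure Q] {R R' P : Measure Ω}
    (hR : IsReverseInfoProj H₀ Q R) (hR' : IsReverseInfoProj H₀ Q R') (hP : P ∈ H₀)
    (hQP : Q ≪ P) : R = R' := by
  obtain ⟨X, hX, rfl⟩ := hR
  obtain ⟨Y, hY, rfl⟩ := hR'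
  refine withDensity_congr_ae ?_
  filter_upwards [hX.ae_eq hY hP hQP] with ω hω
  rw [hω]

lemma IsEntropyLimit.isFiniteMeasure [IsProbabilityMeasure Q] {c : ℝ} {f : Ω → ℝ}
    {Pn : ℕ → Measure Ω} (hlim : IsEntropyLimit H₀ Q c f Pn)
    (h_prob : ∀ P ∈ H₀, IsProbabilityMeasure P) : IsFiniteMeasure (expNegMeasure Q f) := by
  -- Testing against the constant e-variable 1 bounds the mass of the projection by one; it may be
  -- smaller.
  have h1 : IsEVariable H₀ (fun _ => (1 : ℝ≥0∞)) := by
    refine ⟨measurable_const, fun P hP => ?_⟩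
    have := h_prob P hP
    simp
  have h := hlim.lintegral_mul_exp_neg_le h_prob h1
  simp only [mul_one] at h
  exact isFiniteMeasure_withDensity (h.trans_lt ENNReal.one_lt_top).ne

lemma IsEntropyLimit.relEntropy_eq [IsProbabilityMeasure Q] {c : ℝ} {f : Ω → ℝ}
    {Pn : ℕ → Measure Ω} (hlim : IsEntropyLimit H₀ Q c f Pn)
    (h_prob : ∀ P ∈ H₀, IsProbabilityMeasure P) : relEntropy Q (expNegMeasure Q f) = c := by
  have := hlim.isFiniteMeasure h_prob
  have hllr := llr_expNegMeasure (Q := Q) hlim.measurable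
  rw [relEntropy_eq_integral (absolutelyContinuous_expNegMeasure hlim.measurable)
    (hlim.integrable.congr hllr.symm), integral_congr_ae hllr, hlim.integral_eq]

/-- An almost minimizer has a log density close to the one of the projection. -/
lemma IsEntropyLimit.logL1Dist_le [IsProbabilityMeasure Q] {c : ℝ} {f : Ω → ℝ}
    {Pn : ℕ → Measure Ω} (hlim : IsEntropyLimit H₀ Q c f Pn)
    (h_prob : ∀ P ∈ H₀, IsProbabilityMeasure P) (h_conv : Convex ℝ≥0 H₀)
    (hc : (⨅ P ∈ H₀, relEntropy Q P) = (c : EReal)) {μ : Measure Ω} [IsFiniteMeasure μ]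
    (h_dom : ∀ P ∈ H₀, P ≪ μ) (hQ : Q ≪ μ) {P : Measure Ω} (hP : P ∈ H₀) {δ : ℝ} (hδ : 0 < δ)
    (hle : relEntropy Q P ≤ ((c + δ : ℝ) : EReal)) :
    logL1Dist Q (P.rnDeriv μ) ((expNegMeasure Q f).rnDeriv μ)
      ≤ ENNReal.ofReal (2 * δ + 3 * √δ) := by
  have := h_prob P hP
  have := hlim.isFiniteMeasure h_prob
  have hfin := finiteEntropy_of_relEntropy_lt_top (hle.trans_lt (EReal.coe_lt_top _))
  rw [relEntropy_eq_integral hfin.1 hfin.2, EReal.coe_le_coe_iff] at hle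
  rw [logL1Dist_ofReal_exp (rnDeriv_eq_exp_llr hfin.1 (h_dom P hP))
    (rnDeriv_eq_exp_llr (absolutelyContinuous_expNegMeasure hlim.measurable)
      ((expNegMeasure_absolutelyContinuous f).trans hQ))]
  -- The common term `log dQ/dμ` cancels.
  have h1 : ∫⁻ ω, ENNReal.ofReal |llr Q μ ω - llr Q P ω
      - (llr Q μ ω - llr Q (expNegMeasure Q f) ω)| ∂Q
      = ∫⁻ ω, ENNReal.ofReal |llr Q P ω - f ω| ∂Q := by
    refine lintegral_congr_ae ?_
    filter_upwards [llr_expNegMeasure (Q := Q) hlim.measurable] with ω hω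
    rw [hω, sub_sub_sub_cancel_left, abs_sub_comm]
  have hi : Integrable (fun ω => |llr Q P ω - f ω|) Q := (hfin.2.sub hlim.integrable).abs
  rw [h1, ← ofReal_integral_eq_lintegral_ofReal hi
    (ae_of_all _ fun _ => abs_nonneg _)]
  exact ENNReal.ofReal_le_ofReal (hlim.integral_abs_sub_le h_prob h_conv hc hP hfin hδ hle)

lemma IsEntropyLimit.tendsto_logL1Dist [IsProbabilityMeasure Q] {c : ℝ} {f : Ω → ℝ}
    {Pn : ℕ → Measure Ω} (hlim : IsEntropyLimit H₀ Q c f Pn)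
    (h_prob : ∀ P ∈ H₀, IsProbabilityMeasure P) (h_conv : Convex ℝ≥0 H₀)
    (hc : (⨅ P ∈ H₀, relEntropy Q P) = (c : EReal)) {μ : Measure Ω} [IsFiniteMeasure μ]
    (h_dom : ∀ P ∈ H₀, P ≪ μ) (hQ : Q ≪ μ) {P : ℕ → Measure Ω}
    (hP : IsEntropyMinimizing H₀ Q P) :
    Tendsto (fun n => logL1Dist Q ((P n).rnDeriv μ) ((expNegMeasure Q f).rnDeriv μ)) atTop
      (𝓝 0) := by
  rw [ENNReal.tendsto_nhds_zero]
  intro ε hε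
  have hmod := (ENNReal.continuous_ofReal.tendsto _).comp tendsto_modulus
  rw [ENNReal.ofReal_zero] at hmod
  obtain ⟨δ, hδε, hδ⟩ := ((hmod.mono_left nhdsWithin_le_nhds).eventually_le_const hε |>.and
    (self_mem_nhdsWithin (s := Set.Ioi (0 : ℝ)))).exists
  have hlt : (⨅ P ∈ H₀, relEntropy Q P) < ((c + δ : ℝ) : EReal) := by
    rw [hc, EReal.coe_lt_coe_iff]
    exact lt_add_of_pos_right c hδ
  filter_upwards [hP.2.eventually_le_const hlt] with n hn
  exact (hlim.logL1Dist_le h_prob h_conv hc h_dom hQ (hP.1 n) hδ hn).trans hδε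

lemma isEntropyMinimizing_const {P : Measure Ω} (hP : P ∈ H₀)
    (h : relEntropy Q P = ⨅ P ∈ H₀, relEntropy Q P) :
    IsEntropyMinimizing H₀ Q fun _ => P :=
  ⟨fun _ => hP, by simp only [h]; exact tendsto_const_nhds⟩

lemma IsEntropyLimit.isEntropyMinimizing [IsProbabilityMeasure Q] {c : ℝ} {f : Ω → ℝ}
    {Pn : ℕ → Measure Ω} (hlim : IsEntropyLimit H₀ Q c f Pn)
    (h_prob : ∀ P ∈ H₀, IsProbabilityMeasure P)
    (hc : (⨅ P ∈ H₀, relEntropy Q P) = (c : EReal)) : IsEntropyMinimizing H₀ Q Pn := by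
  refine ⟨hlim.mem, ?_⟩
  rw [hc]
  refine ((continuous_coe_real_ereal.tendsto c).comp hlim.tendsto_entropy).congr fun n => ?_
  have := h_prob _ (hlim.mem n)
  exact (relEntropy_eq_integral (hlim.finiteEntropy n).1 (hlim.finiteEntropy n).2).symm

/-- Densities with respect to `μ` that agree `Q`-almost surely determine the absolutely
continuous part. -/
lemma acPart_eq_of_rnDeriv_ae_eq {μ R R' : Measure Ω} [IsFiniteMeasure Q] [IsFiniteMeasure μ]
    [IsFiniteMeasure R] [IsFiniteMeasure R'] (hR : Q ≪ R) (hRμ : R ≪ μ) (hR' : Q ≪ R')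
    (hRμ' : R' ≪ μ) (h : R.rnDeriv μ =ᵐ[Q] R'.rnDeriv μ) : acPart R Q = acPart R' Q := by
  refine withDensity_congr_ae ?_
  filter_upwards [h, rnDeriv_eq_exp_llr hR hRμ, rnDeriv_eq_exp_llr hR' hRμ', exp_neg_llr hR,
    exp_neg_llr hR', R.rnDeriv_lt_top Q, R'.rnDeriv_lt_top Q] with ω h1 h2 h3 h4 h5 h6 h7
  rw [h2, h3, ENNReal.ofReal_eq_ofReal_iff (Real.exp_pos _).le (Real.exp_pos _).le,
    Real.exp_eq_exp] at h1
  rw [← ENNReal.toReal_eq_toReal_iff' h6.ne h7.ne, ← h4, ← h5, Real.exp_eq_exp]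
  linarith

end RIPr

theorem corollary4p11 {Ω : Type*} [MeasurableSpace Ω]
    (Q : Measure Ω) [IsProbabilityMeasure Q]
    (μ : Measure Ω) [IsProbabilityMeasure μ]
    (H₀ : Set (Measure Ω)) (h_prob : ∀ P ∈ H₀, IsProbabilityMeasure P)
    (h_ac : RIPr.AbsContFamily Q H₀)
    (h_dom : ∀ P ∈ H₀, P ≪ μ)
    (h_conv : Convex ℝ≥0 H₀)
    (h_fin : ∃ P ∈ H₀, RIPr.relEntropy Q P < ⊤) :
    ∃ Pstar : Measure Ω,
      -- `Pstar` is the unique reverse information projection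
      RIPr.IsReverseInfoProj H₀ Q Pstar ∧
      (∀ P', RIPr.IsReverseInfoProj H₀ Q P' → P' = Pstar) ∧
      -- along every entropy minimizing sequence, `log p_n → log pstar` in `L¹(Q)`
      (∀ P : ℕ → Measure Ω, RIPr.IsEntropyMinimizing H₀ Q P →
        Tendsto (fun n => RIPr.logL1Dist Q ((P n).rnDeriv μ) (Pstar.rnDeriv μ)) atTop (𝓝 0)) ∧
      -- a minimizer is the reverse information projection, up to `Q`-null sets
      (∀ P' ∈ H₀, RIPr.relEntropy Q P' = (⨅ P ∈ H₀, RIPr.relEntropy Q P) →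
        RIPr.acPart P' Q = Pstar ∧ P'.rnDeriv μ =ᵐ[Q] Pstar.rnDeriv μ) ∧
      -- `Pstar` attains the infimal relative entropy
      RIPr.relEntropy Q Pstar = (⨅ P ∈ H₀, RIPr.relEntropy Q P) ∧
      -- `pstar` is the only density with the above convergence property
      (∀ g : Ω → ℝ≥0∞, Measurable g →
        (∀ P : ℕ → Measure Ω, RIPr.IsEntropyMinimizing H₀ Q P →
          Tendsto (fun n => RIPr.logL1Dist Q ((P n).rnDeriv μ) g) atTop (𝓝 0)) →
        g =ᵐ[Q] Pstar.rnDeriv μ) := by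
  obtain ⟨P₀, hP₀, hP₀fin⟩ := h_fin
  have hP₀prob := h_prob P₀ hP₀
  have hQP₀ := (RIPr.finiteEntropy_of_relEntropy_lt_top hP₀fin).1
  have hQ : Q ≪ μ := hQP₀.trans (h_dom P₀ hP₀)
  obtain ⟨c, hc⟩ : ∃ c : ℝ, (⨅ P ∈ H₀, RIPr.relEntropy Q P) = (c : EReal) := by
    have hnn : 0 ≤ ⨅ P ∈ H₀, RIPr.relEntropy Q P := le_iInf₂ fun P hP => by
      have := h_prob P hP
      exact RIPr.relEntropy_nonneg
    exact ⟨_, (EReal.coe_toReal ((iInf₂_le P₀ hP₀).trans_lt hP₀fin).ne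
      (EReal.bot_lt_zero.trans_le hnn).ne').symm⟩
  obtain ⟨f, Pn, hlim⟩ := RIPr.exists_isEntropyLimit h_prob h_conv hc
  have hfinite := hlim.isFiniteMeasure h_prob
  have hac := RIPr.absolutelyContinuous_expNegMeasure (Q := Q) hlim.measurable
  have hacμ : RIPr.expNegMeasure Q f ≪ μ :=
    (RIPr.expNegMeasure_absolutelyContinuous f).trans hQ
  have hproj : RIPr.IsReverseInfoProj H₀ Q (RIPr.expNegMeasure Q f) :=
    ⟨_, hlim.isNumeraire h_prob h_conv hc hQ h_dom, (RIPr.withDensity_inv_expOnSupport hQ f).symm⟩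
  have hdens := RIPr.rnDeriv_eq_exp_llr hac hacμ
  have hconv := fun P => hlim.tendsto_logL1Dist h_prob h_conv hc h_dom hQ (P := P)
  refine ⟨RIPr.expNegMeasure Q f, hproj, fun P' hP' => hP'.eq hproj hP₀ hQP₀, hconv,
    fun P' hP' hmin => ?_, (hlim.relEntropy_eq h_prob).trans hc.symm, fun g hg hgconv => ?_⟩
  · have := h_prob P' hP'
    have hfin : RIPr.relEntropy Q P' < ⊤ := by rw [hmin, hc]; exact EReal.coe_lt_top _
    have hdist := hconv _ (RIPr.isEntropyMinimizing_const hP' hmin)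
    have hQP' := (RIPr.finiteEntropy_of_relEntropy_lt_top hfin).1
    have hdens' := RIPr.rnDeriv_eq_exp_llr hQP' (h_dom P' hP')
    have hself : RIPr.logL1Dist Q (P'.rnDeriv μ) (P'.rnDeriv μ) = 0 := by
      rw [RIPr.logL1Dist_ofReal_exp hdens' hdens']
      simp
    -- The constant sequence `P'` is minimizing, and its log densities converge both to `log p'` and
    -- to the log density of the projection.
    have heq : P'.rnDeriv μ =ᵐ[Q] (RIPr.expNegMeasure Q f).rnDeriv μ :=
      RIPr.ae_eq_of_tendsto_logL1Dist (p := fun _ => P'.rnDeriv μ)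
        (fun _ => Measure.measurable_rnDeriv _ _) (Measure.measurable_rnDeriv _ _)
        (Measure.measurable_rnDeriv _ _) hdens (by rw [hself]; exact tendsto_const_nhds) hdist
    refine ⟨?_, heq⟩
    rw [RIPr.acPart_eq_of_rnDeriv_ae_eq hQP' (h_dom P' hP') hac hacμ heq, RIPr.acPart,
      Measure.withDensity_rnDeriv_eq _ _ (RIPr.expNegMeasure_absolutelyContinuous f)]
  -- A single minimizing sequence already pins down `g`.
  · have hPn := hlim.isEntropyMinimizing h_prob hc
    exact RIPr.ae_eq_of_tendsto_logL1Dist (fun n => Measure.measurable_rnDeriv (Pn n) μ) hg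
      (Measure.measurable_rnDeriv _ _) hdens (hgconv Pn hPn) (hconv Pn hPn)
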